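/- Let $k\ge 3$ be an integer, let $P_k(w) := \frac{(k-2)w^2-(k-4)w}{2}$, and let $Z_{P_k}$ denote the zeta function $$Z_{P_k}(s) := \sum_{n\ge 1}\frac{1}{P_k(n)^s},$$ which converges absolutely for $\operatorname{Re}(s)>\frac12$, together with its (unique) meromorphic continuation to $\mathbb{C}$. Then: (1) $Z_{P_k}$ is holomorphic at $s=0$, with $$Z_{P_k}(0)=\frac{1}{2-k}\qquad\text{and}\qquad Z_{P_k}'(0)=\frac{\log\left(\frac{k-2}{2}\right)}{k-2}+\log\left(\Gamma\left(\frac{2}{k-2}\right)\right)-\log(2\pi).$$ (2) $\operatorname{Res}_{s=\frac12} Z_{P_k}(s)=\sqrt{\frac{1}{2(k-2)}}$. -/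

import Mathlib

open Filter Topology

noncomputable section

/-- The `k`-gonal polynomial `P_k(w) = ((k - 2) w² - (k - 4) w) / 2`. -/
def polygonalPoly (k : ℕ) : Polynomial ℝ :=
  Polynomial.C (((k : ℝ) - 2) / 2) * Polynomial.X ^ 2
    - Polynomial.C (((k : ℝ) - 4) / 2) * Polynomial.X

/-- The `n`-th term (`n = 0, 1, 2, …`) of the Dirichlet series `∑_{m ≥ 1} 1 / P(m)^s`, the index
being `m = n + 1`; it is used for polynomials that are positive at all positive integers. -/
def polyZetaTerm (P : Polynomial ℝ) (s : ℂ) (n : ℕ) : ℂ :=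
  1 / ((P.eval ((n : ℝ) + 1) : ℝ) : ℂ) ^ s

/-- `Z` is the zeta function of `P`, continued to `ℂ`: it is meromorphic on `ℂ` and equals the
series `∑_{m ≥ 1} 1 / P(m)^s` wherever the latter converges absolutely. "Normal form" says that
`Z` is analytic wherever its singularity is removable (so that its values there are the values of
the continuation), and that `Z` takes the conventional value `0` at its poles. -/
structure IsPolyZeta (P : Polynomial ℝ) (Z : ℂ → ℂ) : Prop where
  meromorphic : MeromorphicNFOn Z Set.univ
  eq_series : ∀ s : ℂ, Summable (polyZetaTerm P s) → Z s = ∑' n : ℕ, polyZetaTerm P s n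

/-- `f` is holomorphic in a punctured neighbourhood of `c` and has residue `ρ` at `c`, i.e.
`(2πi)⁻¹ ∮_{|z - c| = r} f(z) dz = ρ` for all sufficiently small `r > 0`. -/
def HasResidueAt (f : ℂ → ℂ) (c ρ : ℂ) : Prop :=
  (∀ᶠ z in 𝓝[≠] c, AnalyticAt ℂ f z) ∧
    ∀ᶠ r : ℝ in 𝓝[>] 0, (2 * (Real.pi : ℂ) * Complex.I)⁻¹ * (∮ z in C(c, r), f z) = ρ

end

/-! Write `P_k(n) = A n (n - c)` with `A = (k-2)/2`, `c = (k-4)/(k-2)`; then `|c| ≤ 1`, `c < 1` and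
`A (1 - c) = P_k(1) = 1`. Split off `n = 1`, where `k = 3` (`c = -1`) would put the binomial series
on its circle of convergence. For `n ≥ 2`, expanding `(1 - c/n)^(-s)` and exchanging sums gives
`Z(s) = 1 + A^(-s) ∑_j b_j(s) c^j (ζ(2s+j) - 1)` (`hasSum_zetaExpansionTail_zero`). On each ball all
but finitely many terms are holomorphic and their sum converges uniformly, so this is the
continuation.

At `1/2` only `j = 0` is singular, giving residue `A^(-1/2)/2`. At `0` the pole of `ζ(2s+1)` is
cancelled by `b_1(s) = s`, and the tail `j ≥ 2` vanishes with derivative `∑_{j≥2} c^j (ζ(j) - 1)/j`.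
Euler's limit for `log Γ` evaluates this (`hasSum_pow_div_mul_riemannZeta_sub_one`); its `-cγ + c`
cancels against the `j = 1` term.

Uniqueness is the identity theorem for meromorphic functions, with normal form fixing every value.
-/

/-! ### Binomial coefficients of `(1 - x)^(-s)` -/

/-- The coefficient of `x ^ j` in the binomial series of `(1 - x) ^ (-s)`. -/
noncomputable def negBinomCoeff (s : ℂ) (j : ℕ) : ℂ :=
  ∏ i ∈ Finset.range j, (s + i) / (i + 1)

theorem negBinomCoeff_zero (s : ℂ) : negBinomCoeff s 0 = 1 := by simp [negBinomCoeff]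

theorem negBinomCoeff_one (s : ℂ) : negBinomCoeff s 1 = s := by simp [negBinomCoeff]

theorem negBinomCoeff_eq_choose (s : ℂ) (j : ℕ) :
    negBinomCoeff s j = Ring.choose (s + j - 1) j := by
  induction j with
  | zero => simp [negBinomCoeff]
  | succ n ih =>
    have h1 : ((n : ℂ) + 1) ≠ 0 := by exact_mod_cast n.succ_ne_zero
    have hs : negBinomCoeff s (n + 1) = negBinomCoeff s n * ((s + n) / (n + 1)) := by
      exact Finset.prod_range_succ _ _
    have key : ∀ (m : ℕ), (m.factorial : ℂ) * Ring.choose (s + m - 1) m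
        = (ascPochhammer ℂ m).eval s := by
      intro m
      have := Ring.factorial_nsmul_multichoose_eq_ascPochhammer s m
      rw [Ring.multichoose_eq] at this
      rw [nsmul_eq_mul] at this
      rw [this, Polynomial.ascPochhammer_smeval_eq_eval]
    have k1 := key n
    have k2 := key (n + 1)
    rw [ascPochhammer_succ_eval, ← k1, ← ih, Nat.factorial_succ] at k2
    have hf : (n.factorial : ℂ) ≠ 0 := by exact_mod_cast n.factorial_ne_zero
    rw [hs]
    push_cast at k2 ⊢
    field_simp
    apply mul_left_cancel₀ hf
    linear_combination -k2

theorem hasSum_negBinomCoeff (s : ℂ) {x : ℂ} (hx : ‖x‖ < 1) :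
    HasSum (fun j ↦ negBinomCoeff s j * x ^ j) (1 / (1 - x) ^ s) := by
  have h := (Complex.one_div_one_sub_cpow_hasFPowerSeriesOnBall_zero s).hasSum (y := x)
    (by simpa [enorm_eq_nnnorm, ← NNReal.coe_lt_coe] using hx)
  simpa [negBinomCoeff_eq_choose, FormalMultilinearSeries.ofScalars, mul_comm] using h

/-- Each factor obeys `|s + i| ≤ R + i`, so the single point `R` dominates the whole disc; this
makes the later bounds uniform in `s`. -/
theorem norm_negBinomCoeff_le {s : ℂ} {R : ℝ} (hs : ‖s‖ ≤ R) (j : ℕ) :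
    ‖negBinomCoeff s j‖ ≤ ‖negBinomCoeff R j‖ := by
  have hR : 0 ≤ R := (norm_nonneg s).trans hs
  simp only [negBinomCoeff, norm_prod, norm_div]
  refine Finset.prod_le_prod (fun _ _ ↦ by positivity) fun i _ ↦ ?_
  have h2 : ‖(R : ℂ) + i‖ = R + i := by
    rw [← Complex.ofReal_natCast, ← Complex.ofReal_add, Complex.norm_of_nonneg (by positivity)]
  rw [h2]
  gcongr
  exact (norm_add_le _ _).trans (by simpa using hs)

theorem summable_norm_negBinomCoeff (s : ℂ) {r : ℝ} (hr0 : 0 ≤ r) (hr : r < 1) :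
    Summable fun j ↦ ‖negBinomCoeff s j‖ * r ^ j := by
  have h := (hasSum_negBinomCoeff s (x := r) (by simpa [abs_of_nonneg hr0])).summable.norm
  simpa [abs_of_nonneg hr0] using h

theorem differentiable_negBinomCoeff (j : ℕ) : Differentiable ℂ fun s ↦ negBinomCoeff s j := by
  unfold negBinomCoeff
  fun_prop

theorem negBinomCoeff_succ (s : ℂ) (j : ℕ) :
    negBinomCoeff s (j + 1) = s * ((∏ i ∈ Finset.range j, (s + (i + 1))) / (j + 1).factorial) := by
  simp only [negBinomCoeff, Finset.prod_div_distrib]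
  rw [Finset.prod_range_succ' (fun i : ℕ ↦ s + (i : ℂ)), ← Finset.prod_range_add_one_eq_factorial]
  push_cast
  ring

theorem hasDerivAt_negBinomCoeff_zero (j : ℕ) :
    HasDerivAt (fun s ↦ negBinomCoeff s (j + 1)) (1 / (j + 1)) 0 := by
  simp only [negBinomCoeff_succ]
  have h : DifferentiableAt ℂ (fun s : ℂ ↦
      (∏ i ∈ Finset.range j, (s + (i + 1))) / (j + 1).factorial) 0 := by fun_prop
  have h2 := (hasDerivAt_id (0 : ℂ)).mul h.hasDerivAt
  refine h2.congr_deriv ?_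
  have h3 : (∏ i ∈ Finset.range j, ((i : ℂ) + 1)) = j.factorial := by
    rw [← Finset.prod_range_add_one_eq_factorial]; push_cast; rfl
  have hf : (j.factorial : ℂ) ≠ 0 := by exact_mod_cast j.factorial_ne_zero
  have h1 : ((j : ℂ) + 1) ≠ 0 := by exact_mod_cast j.succ_ne_zero
  simp only [id, zero_add, zero_mul, add_zero, one_mul, h3, Nat.factorial_succ]
  push_cast
  field_simp

/-! ### Exponential decay of `ζ(w) - 1` -/

theorem hasSum_riemannZeta_sub_one {s : ℂ} (hs : 1 < s.re) :
    HasSum (fun n : ℕ ↦ 1 / ((n : ℂ) + 2) ^ s) (riemannZeta s - 1) := by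
  have h : Summable fun n : ℕ ↦ 1 / (n : ℂ) ^ s := Complex.summable_one_div_nat_cpow.2 hs
  have h2 := (hasSum_nat_add_iff' 2).2 h.hasSum
  rw [← zeta_eq_tsum_one_div_nat_cpow hs] at h2
  simpa [Finset.sum_range_succ, Complex.zero_cpow (Complex.ne_zero_of_one_lt_re hs)] using h2

theorem norm_natCast_add_two_cpow (n : ℕ) (s : ℂ) :
    ‖((n : ℂ) + 2) ^ s‖ = ((n : ℝ) + 2) ^ s.re := by
  have := Complex.norm_cpow_eq_rpow_re_of_pos (show (0 : ℝ) < (n : ℝ) + 2 by positivity) s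
  push_cast at this
  exact this

theorem summable_one_div_nat_add_two_rpow {β : ℝ} (hβ : 1 < β) :
    Summable fun n : ℕ ↦ 1 / ((n : ℝ) + 2) ^ β := by
  have h := (summable_nat_add_iff 2).2 (Real.summable_one_div_nat_rpow.2 hβ)
  simpa using h

/-- Every base is at least `2`, so the exponent in excess of `β` costs at most `2 ^ (-(w.re - β))`
per term. -/
theorem exists_norm_riemannZeta_sub_one_le {β : ℝ} (hβ : 1 < β) :
    ∃ K : ℝ, 0 ≤ K ∧ ∀ w : ℂ, β ≤ w.re → ‖riemannZeta w - 1‖ ≤ K * 2 ^ (-w.re) := by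
  refine ⟨2 ^ β * ∑' n : ℕ, 1 / ((n : ℝ) + 2) ^ β, ?_, fun w hw ↦ ?_⟩
  · have : 0 ≤ ∑' n : ℕ, 1 / ((n : ℝ) + 2) ^ β := tsum_nonneg fun n ↦ by positivity
    positivity
  have hS := summable_one_div_nat_add_two_rpow hβ
  rw [← (hasSum_riemannZeta_sub_one (hβ.trans_le hw)).tsum_eq]
  have hb : HasSum (fun n : ℕ ↦ 2 ^ (-(w.re - β)) * (1 / ((n : ℝ) + 2) ^ β))
      (2 ^ (-(w.re - β)) * ∑' n : ℕ, 1 / ((n : ℝ) + 2) ^ β) := hS.hasSum.mul_left _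
  refine (tsum_of_norm_bounded hb fun n ↦ ?_).trans_eq ?_
  · rw [norm_div, norm_one, norm_natCast_add_two_cpow, one_div, ← Real.rpow_neg (by positivity),
      one_div, ← Real.rpow_neg (by positivity),
      show -w.re = -(w.re - β) + -β by ring, Real.rpow_add (by positivity)]
    refine mul_le_mul_of_nonneg_right ?_ (by positivity)
    exact Real.rpow_le_rpow_of_nonpos (by norm_num) (by linarith [n.cast_nonneg (α := ℝ)])
      (by linarith)
  · rw [show -(w.re - β) = β + -w.re by ring, Real.rpow_add (by norm_num)]
    ring

/-! ### The expansion into zeta values -/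

/-- The `j`-th term of the expansion of `∑_{n ≥ 2} (n (n - c)) ^ (-s)` into zeta values. -/
noncomputable def zetaExpansionTerm (c : ℝ) (j : ℕ) (s : ℂ) : ℂ :=
  negBinomCoeff s j * (c : ℂ) ^ j * (riemannZeta (2 * s + j) - 1)

/-- The condition on `J` keeps `Re (2s + j + J) ≥ J - 2R > 1` on the ball, away from the pole. The
decay of `ζ - 1` then supplies `2 ^ (-j)`, and the binomial series at `x = 1/2` converges. -/
theorem exists_summable_bound_zetaExpansionTerm {c R : ℝ} (hc : |c| ≤ 1) {J : ℕ}
    (hJ : 1 < J - 2 * R) :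
    ∃ u : ℕ → ℝ, Summable u ∧ ∀ j, ∀ s ∈ Metric.ball (0 : ℂ) R,
      ‖zetaExpansionTerm c (j + J) s‖ ≤ u j := by
  obtain ⟨K, hK0, hK⟩ := exists_norm_riemannZeta_sub_one_le hJ
  refine ⟨fun j ↦ K * 2 ^ (2 * R) * (‖negBinomCoeff R (j + J)‖ * (1 / 2) ^ (j + J)), ?_, ?_⟩
  · exact ((summable_nat_add_iff J).2 (summable_norm_negBinomCoeff R
      (by norm_num : (0 : ℝ) ≤ 1 / 2) (by norm_num))).mul_left _
  intro j s hs
  have hs' : ‖s‖ ≤ R := by simpa using (Metric.mem_ball.1 hs).le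
  have hre : -R ≤ s.re := by
    have := (abs_le.1 (Complex.abs_re_le_norm s)).1
    linarith
  have hw : (2 * s + (j + J : ℕ)).re = 2 * s.re + j + J := by simp; ring
  have h1 := hK (2 * s + (j + J : ℕ)) (by rw [hw]; linarith [j.cast_nonneg (α := ℝ)])
  have h2 : (2 : ℝ) ^ (-(2 * s + (j + J : ℕ)).re) ≤ 2 ^ (2 * R) * (1 / 2) ^ (j + J) := by
    rw [one_div, inv_pow, ← Real.rpow_natCast, ← Real.rpow_neg (by norm_num),
      ← Real.rpow_add (by norm_num), hw]
    refine Real.rpow_le_rpow_of_exponent_le (by norm_num) ?_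
    push_cast
    linarith
  have h3 : ‖(c : ℂ) ^ (j + J)‖ ≤ 1 := by
    rw [norm_pow, Complex.norm_real]; exact pow_le_one₀ (norm_nonneg _) hc
  rw [zetaExpansionTerm, norm_mul, norm_mul]
  calc _ ≤ ‖negBinomCoeff R (j + J)‖ * 1 * (K * (2 ^ (2 * R) * (1 / 2) ^ (j + J))) := by
        refine mul_le_mul (mul_le_mul (norm_negBinomCoeff_le hs' _) h3 (norm_nonneg _)
          (norm_nonneg _)) (h1.trans (mul_le_mul_of_nonneg_left h2 hK0)) (norm_nonneg _)
          (by positivity)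
    _ = _ := by ring

theorem differentiableAt_zetaExpansionTerm (c : ℝ) (j : ℕ) {s : ℂ} (hs : 2 * s + j ≠ 1) :
    DifferentiableAt ℂ (zetaExpansionTerm c j) s := by
  have h : DifferentiableAt ℂ (fun s : ℂ ↦ riemannZeta (2 * s + j)) s :=
    (differentiableAt_riemannZeta hs).comp s (by fun_prop)
  exact ((differentiable_negBinomCoeff j s).mul_const _).mul (h.sub_const 1)

theorem differentiableOn_zetaExpansionTerm (c : ℝ) {R : ℝ} {J : ℕ} (hJ : 1 < J - 2 * R) (j : ℕ) :
    DifferentiableOn ℂ (zetaExpansionTerm c (j + J)) (Metric.ball 0 R) := by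
  intro s hs
  refine (differentiableAt_zetaExpansionTerm c _ fun h ↦ ?_).differentiableWithinAt
  have hs' : ‖s‖ < R := by simpa using hs
  have h1 := (abs_le.1 (Complex.abs_re_le_norm s)).1
  have h2 := congrArg Complex.re h
  simp at h2
  linarith [j.cast_nonneg (α := ℝ)]

theorem summable_zetaExpansionTerm {c : ℝ} (hc : |c| ≤ 1) (s : ℂ) :
    Summable fun j ↦ zetaExpansionTerm c j s := by
  obtain ⟨J, hJ⟩ := exists_nat_gt (1 + 2 * (‖s‖ + 1))
  obtain ⟨u, hu, h⟩ := exists_summable_bound_zetaExpansionTerm hc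
    (by linarith : 1 < J - 2 * (‖s‖ + 1))
  exact (summable_nat_add_iff J).1 (hu.of_norm_bounded fun j ↦ h j s (by simp))

/-- The tail of the expansion of `∑_{n ≥ 2} (n (n - c)) ^ (-s)` into zeta values. -/
noncomputable def zetaExpansionTail (c : ℝ) (J : ℕ) (s : ℂ) : ℂ :=
  ∑' j, zetaExpansionTerm c (j + J) s

theorem zetaExpansionTail_zero_eq {c : ℝ} (hc : |c| ≤ 1) (J : ℕ) (s : ℂ) :
    zetaExpansionTail c 0 s
      = (∑ j ∈ Finset.range J, zetaExpansionTerm c j s) + zetaExpansionTail c J s :=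
  ((summable_zetaExpansionTerm hc s).sum_add_tsum_nat_add J).symm

theorem differentiableOn_zetaExpansionTail {c R : ℝ} (hc : |c| ≤ 1) {J : ℕ}
    (hJ : 1 < J - 2 * R) : DifferentiableOn ℂ (zetaExpansionTail c J) (Metric.ball 0 R) := by
  obtain ⟨u, hu, h⟩ := exists_summable_bound_zetaExpansionTerm hc hJ
  exact Complex.differentiableOn_tsum_of_summable_norm hu (differentiableOn_zetaExpansionTerm c hJ)
    Metric.isOpen_ball h

theorem meromorphicAt_riemannZeta (s : ℂ) : MeromorphicAt riemannZeta s := by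
  have h : MeromorphicAt (fun z : ℂ ↦ (z - 1)⁻¹ + riemannZeta₀ z) s :=
    (((MeromorphicAt.id s).sub (MeromorphicAt.const 1 s)).inv).add
      (differentiable_riemannZeta₀.analyticAt s).meromorphicAt
  refine h.congr ?_
  have : ∀ᶠ z in 𝓝[≠] s, z ≠ 1 := by
    rcases eq_or_ne s 1 with rfl | hs
    · exact self_mem_nhdsWithin
    · exact eventually_nhdsWithin_of_eventually_nhds (eventually_ne_nhds hs)
  filter_upwards [this] with z hz using (riemannZeta_eq_inv_sub_add hz).symm

theorem meromorphicAt_zetaExpansionTerm (c : ℝ) (j : ℕ) (s : ℂ) :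
    MeromorphicAt (zetaExpansionTerm c j) s := by
  have h1 : MeromorphicAt (fun s : ℂ ↦ riemannZeta (2 * s + j)) s := by
    refine (meromorphicAt_riemannZeta _).comp_analyticAt (g := fun s : ℂ ↦ 2 * s + j) ?_
    exact Differentiable.analyticAt (by fun_prop) s
  exact ((((differentiable_negBinomCoeff j).analyticAt s).meromorphicAt).mul
    (MeromorphicAt.const _ s)).mul (h1.sub (MeromorphicAt.const 1 s))

theorem meromorphicAt_zetaExpansionTail_zero {c : ℝ} (hc : |c| ≤ 1) (s : ℂ) :
    MeromorphicAt (zetaExpansionTail c 0) s := by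
  obtain ⟨J, hJ⟩ := exists_nat_gt (1 + 2 * (‖s‖ + 1))
  have h := differentiableOn_zetaExpansionTail hc
    (by linarith : 1 < J - 2 * (‖s‖ + 1))
  have h2 : AnalyticAt ℂ (zetaExpansionTail c J) s :=
    h.analyticAt (Metric.isOpen_ball.mem_nhds (by simp))
  rw [funext (zetaExpansionTail_zero_eq hc J)]
  exact (MeromorphicAt.fun_sum fun j _ ↦ meromorphicAt_zetaExpansionTerm c j s).add
    h2.meromorphicAt

theorem norm_ofReal_div_natCast_add_two_le {c : ℝ} (hc : |c| ≤ 1) (n : ℕ) :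
    ‖(c : ℂ) / (n + 2)‖ ≤ 1 / 2 := by
  have h : ‖(n : ℂ) + 2‖ = n + 2 := by
    exact_mod_cast Complex.norm_natCast (n + 2)
  rw [norm_div, h, Complex.norm_real, Real.norm_eq_abs]
  exact div_le_div₀ zero_le_one hc (by norm_num) (by linarith [n.cast_nonneg (α := ℝ)])

/-- Fubini for the double series over `(n, j)`, dominated by `(n+2)^(-2 Re s)` times the binomial
series at `1/2`. -/
theorem hasSum_zetaExpansionTail_zero {c : ℝ} (hc : |c| ≤ 1) {s : ℂ} (hs : 1 / 2 < s.re) :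
    HasSum (fun n : ℕ ↦ 1 / (1 - (c : ℂ) / (n + 2)) ^ s * (1 / ((n : ℂ) + 2) ^ (2 * s)))
      (zetaExpansionTail c 0 s) := by
  have h2s : 1 < 2 * s.re := by linarith
  let f : ℕ × ℕ → ℂ := fun p ↦
    negBinomCoeff s p.2 * ((c : ℂ) / (p.1 + 2)) ^ p.2 * (1 / ((p.1 : ℂ) + 2) ^ (2 * s))
  have hf : Summable f := by
    have h1 := (summable_one_div_nat_add_two_rpow h2s).mul_of_nonneg
      (summable_norm_negBinomCoeff s (by norm_num : (0 : ℝ) ≤ 1 / 2) (by norm_num))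
      (fun n ↦ by positivity) (fun n ↦ by positivity)
    refine h1.of_norm_bounded fun p ↦ ?_
    have h3 : ‖1 / ((p.1 : ℂ) + 2) ^ (2 * s)‖ = 1 / ((p.1 : ℝ) + 2) ^ (2 * s.re) := by
      rw [norm_div, norm_one, norm_natCast_add_two_cpow]; simp
    rw [norm_mul, norm_mul, norm_pow, h3, mul_comm]
    gcongr
    exact norm_ofReal_div_natCast_add_two_le hc _
  have hn : ∀ n : ℕ, HasSum (fun j ↦ f (n, j))
      (1 / (1 - (c : ℂ) / (n + 2)) ^ s * (1 / ((n : ℂ) + 2) ^ (2 * s))) := by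
    intro n
    have h := hasSum_negBinomCoeff s
      ((norm_ofReal_div_natCast_add_two_le hc n).trans_lt (by norm_num : (1 / 2 : ℝ) < 1))
    exact h.mul_right (1 / ((n : ℂ) + 2) ^ (2 * s))
  have hj : ∀ j : ℕ, HasSum (fun n ↦ f (n, j)) (zetaExpansionTerm c j s) := by
    intro j
    have hre : 1 < (2 * s + j).re := by
      have := j.cast_nonneg (α := ℝ)
      simp
      linarith
    refine ((hasSum_riemannZeta_sub_one hre).mul_left
      (negBinomCoeff s j * (c : ℂ) ^ j)).congr_fun fun n ↦ ?_
    have h0 : (n : ℂ) + 2 ≠ 0 := by exact_mod_cast (n + 1).succ_ne_zero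
    simp only [f]
    rw [Complex.cpow_add _ _ h0, Complex.cpow_natCast, div_pow]
    field_simp
  have e1 := hf.hasSum.prod_fiberwise hn
  have e2 := ((Equiv.prodComm ℕ ℕ).hasSum_iff.2 hf.hasSum).prod_fiberwise hj
  rwa [← e2.tsum_eq] at e1

/-! ### The log-gamma series -/

theorem sum_neg_log_one_sub_div {c : ℝ} (hc : c < 1) (N : ℕ) :
    ∑ n ∈ Finset.range N, (-Real.log (1 - c / (n + 2)) - c / (n + 2))
      = Real.log (1 - c) + Real.log (N + 1).factorial
        - ∑ i ∈ Finset.range (N + 1), Real.log (1 - c + i) - c * harmonic (N + 1) + c := by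
  induction N with
  | zero => simp [harmonic]
  | succ N ih =>
    rw [Finset.sum_range_succ, ih, Finset.sum_range_succ _ (N + 1), harmonic_succ (N + 1),
      Nat.factorial_succ (N + 1)]
    have hN := N.cast_nonneg (α := ℝ)
    have h2 : (1 : ℝ) - c / (N + 2) = (1 - c + (N + 1 : ℕ)) / (N + 2) := by
      push_cast
      field_simp
      ring
    rw [h2, Real.log_div (by push_cast; linarith) (by linarith), Nat.cast_mul,
      Real.log_mul (by positivity) (by positivity)]
    push_cast
    rw [show (N : ℝ) + 1 + 1 = N + 2 by ring]
    field_simp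
    ring

theorem tendsto_sum_neg_log_one_sub_div {c : ℝ} (hc : c < 1) :
    Tendsto (fun N ↦ ∑ n ∈ Finset.range N, (-Real.log (1 - c / (n + 2)) - c / (n + 2))) atTop
      (𝓝 (Real.log (1 - c) + Real.log (Real.Gamma (1 - c))
        - c * Real.eulerMascheroniConstant + c)) := by
  have h1 := (tendsto_add_atTop_iff_nat 1).2
    (Real.BohrMollerup.tendsto_log_gamma (sub_pos.2 hc))
  have h2 := ((tendsto_add_atTop_iff_nat 1).2 Real.tendsto_harmonic_sub_log).const_mul c
  -- `logGammaSeq` contains one more logarithm than the partial sum; against one `log (N + 1)` it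
  -- tends to `0`.
  have h3 := (tendsto_add_atTop_iff_nat 1).2
    ((Real.tendsto_log_comp_add_sub_log (1 - c)).comp tendsto_natCast_atTop_atTop)
  have h4 := (((h1.const_add (Real.log (1 - c))).sub h2).add h3).add_const c
  rw [add_zero] at h4
  refine h4.congr fun N ↦ ?_
  rw [sum_neg_log_one_sub_div hc, Real.BohrMollerup.logGammaSeq, Finset.sum_range_succ _ (N + 1)]
  simp only [Function.comp_apply]
  rw [add_comm (1 - c) ((N + 1 : ℕ) : ℝ)]
  ring

theorem hasSum_pow_div_mul_riemannZeta_sub_one {c : ℝ} (hc : |c| ≤ 1) (hc1 : c < 1) :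
    HasSum (fun j : ℕ ↦ 1 / ((j + 1 : ℕ) + 1) * (c : ℂ) ^ (j + 2) * (riemannZeta (j + 2 : ℕ) - 1))
      ((Real.log (1 - c) + Real.log (Real.Gamma (1 - c))
        - c * Real.eulerMascheroniConstant + c : ℝ) : ℂ) := by
  let f : ℕ × ℕ → ℝ := fun p ↦ (c / (p.1 + 2)) ^ (p.2 + 2) / ((p.2 + 1 : ℕ) + 1)
  have hq : ∀ n : ℕ, |c / (n + 2)| ≤ 1 / 2 := fun n ↦ by
    have := norm_ofReal_div_natCast_add_two_le hc n
    rw [← Real.norm_eq_abs, ← Complex.norm_real]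
    simpa using this
  have hf : Summable f := by
    have h1 := (summable_one_div_nat_add_two_rpow (by norm_num : (1 : ℝ) < 2)).mul_of_nonneg
      (summable_geometric_two) (fun n ↦ by positivity) (fun n ↦ by positivity)
    refine h1.of_norm_bounded fun p ↦ ?_
    -- Two powers of `c / (n+2)` give summability in `n`; the remaining ones give the geometric
    -- series in `j`.
    have h3 : |c / ((p.1 : ℝ) + 2)| ^ 2 ≤ 1 / ((p.1 : ℝ) + 2) ^ (2 : ℝ) := by
      rw [abs_div, div_pow, sq_abs, sq_abs, Real.rpow_two]
      gcongr
      exact (sq_le_one_iff_abs_le_one c).2 hc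
    rw [norm_div, norm_pow, Real.norm_eq_abs, add_comm p.2 2, pow_add]
    refine (div_le_self (by positivity) ?_).trans
      (mul_le_mul h3 (pow_le_pow_left₀ (abs_nonneg _) (hq _) _) (by positivity) (by positivity))
    rw [Real.norm_of_nonneg (by positivity)]
    linarith [(p.2 + 1).cast_nonneg (α := ℝ)]
  have hn : ∀ n : ℕ, HasSum (fun j ↦ f (n, j)) (-Real.log (1 - c / (n + 2)) - c / (n + 2)) := by
    intro n
    have := (hasSum_nat_add_iff' 1).2
      (Real.hasSum_pow_div_log_of_abs_lt_one ((hq n).trans_lt (by norm_num)))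
    simpa [f, add_assoc] using this
  have e1 := (hf.hasSum.prod_fiberwise hn).tendsto_sum_nat
  have hT := tendsto_nhds_unique e1 (tendsto_sum_neg_log_one_sub_div hc1)
  have hsum : HasSum (fun p ↦ (f p : ℂ)) _ := Complex.hasSum_ofReal.2 (hT ▸ hf.hasSum)
  refine ((Equiv.prodComm ℕ ℕ).hasSum_iff.2 hsum).prod_fiberwise fun j ↦ ?_
  have hre : 1 < ((j + 2 : ℕ) : ℂ).re := by
    rw [Complex.natCast_re]; exact_mod_cast (by omega : 1 < j + 2)
  refine ((hasSum_riemannZeta_sub_one hre).mul_left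
    (1 / ((j + 1 : ℕ) + 1) * (c : ℂ) ^ (j + 2))).congr_fun fun n ↦ ?_
  simp only [f, Function.comp_apply, Equiv.prodComm_apply, Prod.swap, Complex.cpow_natCast]
  push_cast
  rw [div_pow]
  ring

theorem hasDerivAt_zetaExpansionTerm_zero (c : ℝ) (j : ℕ) :
    HasDerivAt (zetaExpansionTerm c (j + 2))
      (1 / ((j + 1 : ℕ) + 1) * (c : ℂ) ^ (j + 2) * (riemannZeta (j + 2 : ℕ) - 1)) 0 := by
  have hne : 2 * (0 : ℂ) + (j + 2 : ℕ) ≠ 1 := by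
    rw [mul_zero, zero_add]
    exact_mod_cast (by omega : j + 2 ≠ 1)
  have hz : DifferentiableAt ℂ (fun s : ℂ ↦ riemannZeta (2 * s + (j + 2 : ℕ)) - 1) 0 :=
    ((differentiableAt_riemannZeta hne).comp (0 : ℂ)
      (f := fun s : ℂ ↦ 2 * s + (j + 2 : ℕ)) (by fun_prop)).sub_const 1
  have h := ((hasDerivAt_negBinomCoeff_zero (j + 1)).mul_const ((c : ℂ) ^ (j + 2))).mul
    hz.hasDerivAt
  refine h.congr_deriv ?_
  simp [negBinomCoeff_succ]

theorem zetaExpansionTail_two_zero (c : ℝ) : zetaExpansionTail c 2 0 = 0 := by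
  simp [zetaExpansionTail, zetaExpansionTerm, negBinomCoeff_succ]

theorem analyticAt_zetaExpansionTail_two {c : ℝ} (hc : |c| ≤ 1) :
    AnalyticAt ℂ (zetaExpansionTail c 2) 0 :=
  (differentiableOn_zetaExpansionTail hc (R := 1 / 4) (by norm_num)).analyticAt
    (Metric.isOpen_ball.mem_nhds (by simp))

theorem hasDerivAt_zetaExpansionTail_two {c : ℝ} (hc : |c| ≤ 1) (hc1 : c < 1) :
    HasDerivAt (zetaExpansionTail c 2) ((Real.log (1 - c) + Real.log (Real.Gamma (1 - c))
        - c * Real.eulerMascheroniConstant + c : ℝ) : ℂ) 0 := by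
  have hJ : 1 < ((2 : ℕ) : ℝ) - 2 * (1 / 4) := by norm_num
  obtain ⟨u, hu, h⟩ := exists_summable_bound_zetaExpansionTerm hc hJ
  have h1 := Complex.hasSum_deriv_of_summable_norm hu (differentiableOn_zetaExpansionTerm c hJ)
    Metric.isOpen_ball h (z := 0) (by simp)
  simp only [(hasDerivAt_zetaExpansionTerm_zero c _).deriv] at h1
  rw [(hasSum_pow_div_mul_riemannZeta_sub_one hc hc1).unique h1]
  exact (analyticAt_zetaExpansionTail_two hc).differentiableAt.hasDerivAt

/-! ### The continued zeta function of a quadratic -/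

/-- The meromorphic continuation of `∑_{n ≥ 1} (A n (n - c)) ^ (-s)` when `A (1 - c) = 1`. -/
noncomputable def quadraticZeta (A c : ℝ) (s : ℂ) : ℂ :=
  1 + (A : ℂ) ^ (-s) * zetaExpansionTail c 0 s

theorem differentiable_const_cpow_neg {A : ℝ} (hA : 0 < A) :
    Differentiable ℂ fun s : ℂ ↦ (A : ℂ) ^ (-s) := fun s ↦
  (differentiableAt_id.neg).const_cpow (Or.inl (by exact_mod_cast hA.ne'))

theorem meromorphicAt_quadraticZeta {A c : ℝ} (hA : 0 < A) (hc : |c| ≤ 1) (s : ℂ) :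
    MeromorphicAt (quadraticZeta A c) s :=
  (MeromorphicAt.const 1 s).add (((differentiable_const_cpow_neg hA).analyticAt s).meromorphicAt.mul
    (meromorphicAt_zetaExpansionTail_zero hc s))

theorem isOpen_half_lt_re : IsOpen {s : ℂ | 1 / 2 < s.re} :=
  isOpen_lt continuous_const Complex.continuous_re

theorem analyticAt_quadraticZeta {A c : ℝ} (hA : 0 < A) (hc : |c| ≤ 1) {s : ℂ}
    (hs : 1 / 2 < s.re) : AnalyticAt ℂ (quadraticZeta A c) s := by
  have h : DifferentiableOn ℂ (quadraticZeta A c) {s : ℂ | 1 / 2 < s.re} := by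
    intro z hz
    obtain ⟨J, hJ⟩ := exists_nat_gt (1 + 2 * (‖z‖ + 1))
    have hF := (differentiableOn_zetaExpansionTail hc (R := ‖z‖ + 1) (J := J)
      (by linarith)).differentiableAt (Metric.isOpen_ball.mem_nhds (by simp : z ∈ _))
    have hE : DifferentiableAt ℂ (zetaExpansionTail c 0) z := by
      rw [funext (zetaExpansionTail_zero_eq hc J)]
      refine DifferentiableAt.add (DifferentiableAt.fun_sum fun j _ ↦ ?_) hF
      refine differentiableAt_zetaExpansionTerm c j fun h ↦ ?_
      have h2 := congrArg Complex.re h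
      have hz' : 1 / 2 < z.re := hz
      simp at h2
      linarith [j.cast_nonneg (α := ℝ)]
    exact ((((differentiable_const_cpow_neg hA) z).mul hE).const_add 1).differentiableWithinAt
  exact h.analyticAt (isOpen_half_lt_re.mem_nhds hs)

theorem hasSum_quadraticZeta {A c : ℝ} (hA : 0 < A) (hc : |c| ≤ 1) (hAc : A * (1 - c) = 1) {s : ℂ}
    (hs : 1 / 2 < s.re) :
    HasSum (fun n : ℕ ↦ 1 / ((A * ((n + 1) * (n + 1 - c)) : ℝ) : ℂ) ^ s) (quadraticZeta A c s) := by
  refine (hasSum_nat_add_iff' 1).1 ?_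
  have h := (hasSum_zetaExpansionTail_zero hc hs).mul_left ((A : ℂ) ^ (-s))
  have h0 : quadraticZeta A c s - ∑ n ∈ Finset.range 1,
      1 / ((A * ((n + 1) * (n + 1 - c)) : ℝ) : ℂ) ^ s = (A : ℂ) ^ (-s) * zetaExpansionTail c 0 s := by
    simp [hAc, quadraticZeta, -Complex.ofReal_mul]
  rw [h0]
  refine h.congr_fun fun n ↦ ?_
  have hn := n.cast_nonneg (α := ℝ)
  have hq : 0 ≤ 1 - c / (n + 2) := by
    rw [sub_nonneg, div_le_one (by linarith)]
    linarith [(abs_le.1 hc).2]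
  have e : A * (((n + 1 : ℕ) + 1) * ((n + 1 : ℕ) + 1 - c))
      = A * ((n + 2 : ℝ) * ((n + 2) * (1 - c / (n + 2)))) := by
    push_cast
    field_simp
    ring
  have h2 : (n : ℂ) + 2 = ((n + 2 : ℝ) : ℂ) := by push_cast; rfl
  have h3 : (1 : ℂ) - c / (n + 2) = ((1 - c / (n + 2) : ℝ) : ℂ) := by push_cast; rfl
  have h4 : ((n : ℂ) + 2) ≠ 0 := by exact_mod_cast (n + 1).succ_ne_zero
  rw [e, h3, two_mul s, Complex.cpow_add _ _ h4, h2, Complex.ofReal_mul,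
    Complex.mul_cpow_ofReal_nonneg hA.le (by positivity), Complex.ofReal_mul,
    Complex.mul_cpow_ofReal_nonneg (by positivity) (by positivity), Complex.ofReal_mul,
    Complex.mul_cpow_ofReal_nonneg (by positivity) hq, Complex.cpow_neg]
  ring

/-- `IsPolyZeta` constrains `Z` wherever the series is summable, so no such point may lie outside
the half-plane. If `Re s ≤ 1/2`, the terms dominate a harmonic series. -/
theorem half_lt_re_of_summable {A c : ℝ} (hA : 0 < A) (hc : |c| ≤ 1) (hAc : A * (1 - c) = 1) {s : ℂ}
    (hs : Summable fun n : ℕ ↦ 1 / ((A * ((n + 1) * (n + 1 - c)) : ℝ) : ℂ) ^ s) :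
    1 / 2 < s.re := by
  by_contra! hre
  have h1c : 0 ≤ 1 - c := by linarith [(abs_le.1 hc).2]
  have hle : ∀ n : ℕ, (√A)⁻¹ * (1 / ((n : ℝ) + 2)) ≤
      ‖1 / ((A * ((n + 1) * (n + 1 - c)) : ℝ) : ℂ) ^ s‖ := by
    intro n
    have hn := n.cast_nonneg (α := ℝ)
    -- A base at least `1` makes the power monotone in the exponent, which also covers `Re s < 0`.
    have hP : 1 ≤ A * (((n : ℝ) + 1) * (n + 1 - c)) := by
      rw [← hAc]
      refine mul_le_mul_of_nonneg_left ?_ hA.le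
      nlinarith
    have hP2 : A * (((n : ℝ) + 1) * (n + 1 - c)) ≤ A * (n + 2) ^ 2 := by
      refine mul_le_mul_of_nonneg_left ?_ hA.le
      have := (abs_le.1 hc).1
      nlinarith
    rw [norm_div, norm_one, Complex.norm_cpow_eq_rpow_re_of_pos (by linarith), inv_eq_one_div,
      one_div_mul_one_div]
    refine one_div_le_one_div_of_le (by positivity) ?_
    calc _ ≤ (A * (((n : ℝ) + 1) * (n + 1 - c))) ^ (1 / 2 : ℝ) :=
          Real.rpow_le_rpow_of_exponent_le hP hre
      _ = √(A * (((n : ℝ) + 1) * (n + 1 - c))) := (Real.sqrt_eq_rpow _).symm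
      _ ≤ √(A * (n + 2) ^ 2) := Real.sqrt_le_sqrt hP2
      _ = _ := by rw [Real.sqrt_mul hA.le, Real.sqrt_sq (by linarith)]
  have h1 := Summable.of_nonneg_of_le (fun n ↦ by positivity) hle hs.norm
  rw [summable_mul_left_iff (by positivity)] at h1
  refine Real.not_summable_one_div_natCast ((summable_nat_add_iff 2).1 ?_)
  simpa using h1

theorem polygonalPoly_eval_natCast_add_one {k : ℕ} (hk : 3 ≤ k) (n : ℕ) :
    (polygonalPoly k).eval ((n : ℝ) + 1)
      = ((k : ℝ) - 2) / 2 * ((n + 1) * (n + 1 - ((k : ℝ) - 4) / (k - 2))) := by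
  have : (3 : ℝ) ≤ k := by exact_mod_cast hk
  have h : (k : ℝ) - 2 ≠ 0 := by linarith
  simp [polygonalPoly]
  field_simp

/-! ### Identity theorem, residue, and behaviour at zero -/

/-- Infinite order of `f - g` at one point propagates over the connected plane. -/
theorem eventuallyEq_nhdsNE_of_meromorphicAt_of_eqOn {f g : ℂ → ℂ} (hf : ∀ z, MeromorphicAt f z)
    (hg : ∀ z, MeromorphicAt g z) {U : Set ℂ} {x : ℂ} (hU : U ∈ 𝓝 x) (h : Set.EqOn f g U) (z : ℂ) :
    f =ᶠ[𝓝[≠] z] g := by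
  have hm : Meromorphic (f - g) := fun z ↦ (hf z).sub (hg z)
  have hx : meromorphicOrderAt (f - g) x = ⊤ := by
    rw [meromorphicOrderAt_eq_top_iff]
    filter_upwards [mem_nhdsWithin_of_mem_nhds hU] with w hw
    simp [h hw]
  have hz : meromorphicOrderAt (f - g) z = ⊤ := by
    by_contra hz
    exact (hm.exists_meromorphicOrderAt_ne_top_iff_forall.1 ⟨z, hz⟩) x hx
  filter_upwards [meromorphicOrderAt_eq_top_iff.1 hz] with w hw
  simpa [sub_eq_zero] using hw

theorem hasResidueAt_of_tendsto {f : ℂ → ℂ} {c ρ : ℂ} (hf : MeromorphicAt f c)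
    (h : Tendsto (fun z ↦ (z - c) * f z) (𝓝[≠] c) (𝓝 ρ)) : HasResidueAt f c ρ := by
  refine ⟨hf.eventually_analyticAt, ?_⟩
  obtain ⟨ε, hε, hball⟩ := Metric.mem_nhdsWithin_iff.1 hf.eventually_analyticAt
  filter_upwards [Ioo_mem_nhdsGT hε] with r hr
  -- Filling in the removable singularity of `(z - c) f` turns the residue into Cauchy's formula at
  -- the centre.
  let g : ℂ → ℂ := Function.update (fun z ↦ (z - c) * f z) c ρ
  have hgne : ∀ z, z ≠ c → g z = (z - c) * f z := fun z hz ↦ Function.update_of_ne hz _ _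
  have hd : ∀ z ∈ Metric.closedBall c r, z ≠ c → DifferentiableAt ℂ g z := by
    intro z hz hzc
    have hz' : z ∈ Metric.ball c ε := Metric.closedBall_subset_ball hr.2 hz
    have h1 : DifferentiableAt ℂ f z := AnalyticAt.differentiableAt (hball ⟨hz', hzc⟩)
    refine DifferentiableAt.congr_of_eventuallyEq (f := fun z ↦ (z - c) * f z)
      ((differentiableAt_id.sub_const c).mul h1) ?_
    filter_upwards [eventually_ne_nhds hzc] with w hw using hgne w hw
  have hcont : ContinuousOn g (Metric.closedBall c r) := by
    intro z hz
    rcases eq_or_ne z c with rfl | hzc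
    · exact (continuousAt_update_same.2 h).continuousWithinAt
    · exact (hd z hz hzc).continuousAt.continuousWithinAt
  have key := Complex.two_pi_I_inv_smul_circleIntegral_sub_inv_smul_of_differentiable_on_off_countable
    (Set.countable_singleton c) (Metric.mem_ball_self hr.1) hcont
    (fun z hz ↦ hd z (Metric.ball_subset_closedBall hz.1) hz.2)
  rw [show g c = ρ from Function.update_self _ _ _, smul_eq_mul] at key
  rw [← key]
  congr 1
  refine circleIntegral.integral_congr hr.1.le fun z hz ↦ ?_
  have hzc : z ≠ c := by
    rintro rfl
    simp [hr.1.ne] at hz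
  have : z - c ≠ 0 := sub_ne_zero.2 hzc
  simp [hgne z hzc, this]

theorem tendsto_sub_half_mul_quadraticZeta {A c : ℝ} (hA : 0 < A) (hc : |c| ≤ 1) :
    Tendsto (fun z ↦ (z - 1 / 2) * quadraticZeta A c z) (𝓝[≠] (1 / 2))
      (𝓝 ((A : ℂ) ^ (-(1 / 2) : ℂ) / 2)) := by
  let H : ℂ → ℂ := fun s ↦ riemannZeta₀ (2 * s) - 1 +
    (zetaExpansionTerm c 1 s + zetaExpansionTerm c 2 s + zetaExpansionTerm c 3 s)
    + zetaExpansionTail c 4 s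
  have hF : DifferentiableAt ℂ (zetaExpansionTail c 4) (1 / 2) :=
    (differentiableOn_zetaExpansionTail hc (R := 1) (J := 4) (by norm_num)).differentiableAt
      (Metric.isOpen_ball.mem_nhds (by simp; norm_num))
  have hT : ∀ j : ℕ, 1 ≤ j → DifferentiableAt ℂ (zetaExpansionTerm c j) (1 / 2) := by
    intro j hj
    refine differentiableAt_zetaExpansionTerm c j fun h ↦ ?_
    have h2 := congrArg Complex.re h
    have : (1 : ℝ) ≤ j := by exact_mod_cast hj
    simp at h2
    omega
  have hZ : DifferentiableAt ℂ (fun s : ℂ ↦ riemannZeta₀ (2 * s)) (1 / 2) :=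
    (differentiable_riemannZeta₀.comp (by fun_prop : Differentiable ℂ fun s : ℂ ↦ 2 * s)) _
  have hH : DifferentiableAt ℂ H (1 / 2) :=
    ((hZ.sub_const 1).add (((hT 1 le_rfl).add (hT 2 (by norm_num))).add
      (hT 3 (by norm_num)))).add hF
  have hA' := (differentiable_const_cpow_neg hA).continuous.continuousAt (x := 1 / 2)
  have hG : ContinuousAt (fun z : ℂ ↦ (z - 1 / 2) * (1 + (A : ℂ) ^ (-z) * H z)
      + (A : ℂ) ^ (-z) / 2) (1 / 2) :=
    ((continuousAt_id.sub continuousAt_const).mul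
      (continuousAt_const.add (hA'.mul hH.continuousAt))).add (hA'.div_const 2)
  have hlim := hG.tendsto.mono_left (nhdsWithin_le_nhds (s := {(1 / 2 : ℂ)}ᶜ))
  rw [sub_self, zero_mul, zero_add] at hlim
  refine hlim.congr' ?_
  filter_upwards [self_mem_nhdsWithin] with z hz
  have hz' : 2 * z ≠ 1 := fun h ↦ hz (by
    rw [Set.mem_singleton_iff]
    linear_combination h / 2)
  have hz1 : 2 * z - 1 ≠ 0 := sub_ne_zero.2 hz'
  rw [quadraticZeta, zetaExpansionTail_zero_eq hc 4]
  simp only [Finset.sum_range_succ, Finset.sum_range_zero, H]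
  have h0 : zetaExpansionTerm c 0 z = (2 * z - 1)⁻¹ + riemannZeta₀ (2 * z) - 1 := by
    simp [zetaExpansionTerm, negBinomCoeff_zero, riemannZeta_eq_inv_sub_add hz']
  rw [h0]
  linear_combination (-(A : ℂ) ^ (-z) / 2) * mul_inv_cancel₀ hz1

/-- A separate `g` is needed: at `s = 0` the factor `s` kills the `j = 1` term of `quadraticZeta`,
whose limit is `c / 2`. -/
theorem exists_analyticAt_quadraticZeta_zero {A c : ℝ} (hA : 0 < A) (hc : |c| ≤ 1) (hc1 : c < 1) :
    ∃ g : ℂ → ℂ, AnalyticAt ℂ g 0 ∧ quadraticZeta A c =ᶠ[𝓝[≠] 0] g ∧ g 0 = ((c - 1) / 2 : ℝ) ∧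
      HasDerivAt g ((Real.log A * ((3 - c) / 2) + Real.log (1 - c) + Real.log (Real.Gamma (1 - c))
        - Real.log (2 * Real.pi) : ℝ) : ℂ) 0 := by
  -- The middle summand is `s c (ζ(2s+1) - 1)` with its polar part `s c / (2s) = c / 2` made
  -- explicit.
  let E : ℂ → ℂ := fun s ↦ (riemannZeta (2 * s) - 1) +
    (c / 2 + s * (c * (riemannZeta₀ (2 * s + 1) - 1))) + zetaExpansionTail c 2 s
  have hA0 : (A : ℂ) ≠ 0 := by exact_mod_cast hA.ne'
  have dz : HasDerivAt (fun s : ℂ ↦ riemannZeta (2 * s))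
      ((-Complex.log (2 * Real.pi) / 2) * 2) 0 := by
    have h1 : HasDerivAt riemannZeta (-Complex.log (2 * Real.pi) / 2) (2 * 0) := by
      rw [mul_zero, ← deriv_riemannZeta_zero]
      exact (differentiableAt_riemannZeta zero_ne_one).hasDerivAt
    have h2 : HasDerivAt (fun s : ℂ ↦ 2 * s) 2 0 := by
      simpa using (hasDerivAt_id (0 : ℂ)).const_mul 2
    exact h1.comp 0 h2
  have d0 : Differentiable ℂ (fun s : ℂ ↦ (c : ℂ) * (riemannZeta₀ (2 * s + 1) - 1)) :=
    ((differentiable_riemannZeta₀.comp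
      (by fun_prop : Differentiable ℂ fun s : ℂ ↦ 2 * s + 1)).sub_const 1).const_mul _
  have hE : HasDerivAt E _ 0 := (((dz.sub_const 1).add
    (((hasDerivAt_id 0).mul (d0 0).hasDerivAt).const_add ((c : ℂ) / 2))).add
    (hasDerivAt_zetaExpansionTail_two hc hc1))
  have hpow : HasDerivAt (fun s : ℂ ↦ (A : ℂ) ^ (-s)) _ 0 :=
    (hasDerivAt_id (0 : ℂ)).neg.const_cpow (Or.inl hA0)
  have hg := (hpow.mul hE).const_add 1
  refine ⟨fun s ↦ 1 + (A : ℂ) ^ (-s) * E s, ?_, ?_, ?_, ?_⟩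
  · have h1 : AnalyticAt ℂ (fun s : ℂ ↦ riemannZeta (2 * s)) 0 := by
      refine DifferentiableOn.analyticAt (s := {s : ℂ | 2 * s ≠ 1}) (fun s hs ↦ ?_) ?_
      · exact ((differentiableAt_riemannZeta hs).comp s
          (f := fun s : ℂ ↦ 2 * s) (by fun_prop)).differentiableWithinAt
      · exact (isOpen_ne_fun (by fun_prop) (by fun_prop)).mem_nhds (by simp)
    have h2 : AnalyticAt ℂ E 0 := ((h1.sub analyticAt_const).add (analyticAt_const.add
      (analyticAt_id.mul (d0.analyticAt 0)))).add (analyticAt_zetaExpansionTail_two hc)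
    exact analyticAt_const.add (((differentiable_const_cpow_neg hA).analyticAt 0).mul h2)
  · filter_upwards [self_mem_nhdsWithin] with s hs
    have hs0 : s ≠ 0 := hs
    have h1 : 2 * s + 1 ≠ 1 := by simpa using hs0
    rw [quadraticZeta, zetaExpansionTail_zero_eq hc 2]
    simp only [Finset.sum_range_succ, Finset.sum_range_zero, zetaExpansionTerm, negBinomCoeff_zero,
      negBinomCoeff_one, E, Nat.cast_zero, Nat.cast_one, riemannZeta_eq_inv_sub_add h1]
    simp only [add_sub_cancel_right, add_zero, pow_zero, pow_one]
    field_simp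
    ring
  · simp only [E, zetaExpansionTail_two_zero, mul_zero, riemannZeta_zero, neg_zero,
      Complex.cpow_zero]
    push_cast
    ring
  · refine hg.congr_deriv ?_
    simp only [E, zetaExpansionTail_two_zero, mul_zero, zero_mul, riemannZeta_zero, neg_zero,
      Complex.cpow_zero, zero_add, riemannZeta₀_one, id, Pi.neg_apply]
    push_cast [Complex.ofReal_log hA.le, Complex.ofReal_log Real.two_pi_pos.le]
    ring

/-! ### Specialization to polygonal numbers -/

theorem polyZetaTerm_polygonalPoly {k : ℕ} (hk : 3 ≤ k) (s : ℂ) :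
    polyZetaTerm (polygonalPoly k) s = fun n : ℕ ↦
      1 / ((((k : ℝ) - 2) / 2 * ((n + 1) * (n + 1 - ((k : ℝ) - 4) / (k - 2))) : ℝ) : ℂ) ^ s := by
  funext n
  rw [polyZetaTerm, polygonalPoly_eval_natCast_add_one hk]

/-- Passing to normal form leaves values unchanged where `G` is analytic, in particular where the
series is summable. -/
theorem isPolyZeta_toMeromorphicNFOn {P : Polynomial ℝ} {G : ℂ → ℂ} (hG : ∀ z, MeromorphicAt G z)
    (ha : ∀ s, Summable (polyZetaTerm P s) → AnalyticAt ℂ G s)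
    (hs : ∀ s, Summable (polyZetaTerm P s) → HasSum (polyZetaTerm P s) (G s)) :
    IsPolyZeta P (toMeromorphicNFOn G Set.univ) := by
  have hm : MeromorphicOn G Set.univ := fun z _ ↦ hG z
  have hnf := meromorphicNFOn_toMeromorphicNFOn G Set.univ
  refine ⟨hnf, fun s h ↦ ?_⟩
  have h1 := hm.toMeromorphicNFOn_eq_self_on_nhdsNE (Set.mem_univ s)
  have h2 := ((hnf (Set.mem_univ s)).eventuallyEq_nhdsNE_iff_eventuallyEq_nhds
    (ha s h).meromorphicNFAt).1 h1
  rw [h2.eq_of_nhds, (hs s h).tsum_eq]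

theorem mainTheorem9 (k : ℕ) (hk : 3 ≤ k) :
    (∃! Z : ℂ → ℂ, IsPolyZeta (polygonalPoly k) Z) ∧
    ∀ Z : ℂ → ℂ, IsPolyZeta (polygonalPoly k) Z →
      AnalyticAt ℂ Z 0 ∧
      Z 0 = 1 / (2 - (k : ℂ)) ∧
      HasDerivAt Z
        ((Real.log (((k : ℝ) - 2) / 2) / ((k : ℝ) - 2)
          + Real.log (Real.Gamma (2 / ((k : ℝ) - 2)))
          - Real.log (2 * Real.pi) : ℝ) : ℂ) 0 ∧
      HasResidueAt Z (1 / 2) ((Real.sqrt (1 / (2 * ((k : ℝ) - 2))) : ℝ) : ℂ) := by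
  have hk3 : (3 : ℝ) ≤ k := by exact_mod_cast hk
  have hk2 : 0 < (k : ℝ) - 2 := by linarith
  obtain ⟨A, hAdef⟩ : ∃ A : ℝ, A = ((k : ℝ) - 2) / 2 := ⟨_, rfl⟩
  obtain ⟨c, hcdef⟩ : ∃ c : ℝ, c = ((k : ℝ) - 4) / (k - 2) := ⟨_, rfl⟩
  have hA : 0 < A := by rw [hAdef]; positivity
  have h1c : 1 - c = 2 / ((k : ℝ) - 2) := by rw [hcdef]; field_simp; ring
  have hc1 : c < 1 := sub_pos.1 (h1c ▸ by positivity)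
  have hc : |c| ≤ 1 := by
    have : 1 - c ≤ 2 := by rw [h1c, div_le_iff₀ hk2]; linarith
    exact abs_le.2 ⟨by linarith, hc1.le⟩
  have hAc : A * (1 - c) = 1 := by rw [h1c, hAdef]; field_simp
  have hterm := polyZetaTerm_polygonalPoly hk
  rw [← hAdef, ← hcdef] at hterm
  have hre : ∀ s, Summable (polyZetaTerm (polygonalPoly k) s) → 1 / 2 < s.re := fun s hs ↦
    half_lt_re_of_summable hA hc hAc (hterm s ▸ hs)
  have hsum : ∀ s : ℂ, 1 / 2 < s.re →
      HasSum (polyZetaTerm (polygonalPoly k) s) (quadraticZeta A c s) := fun s hs ↦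
    hterm s ▸ hasSum_quadraticZeta hA hc hAc hs
  have hG := meromorphicAt_quadraticZeta hA hc
  have hU : {s : ℂ | 1 / 2 < s.re} ∈ 𝓝 (1 : ℂ) := isOpen_half_lt_re.mem_nhds (by norm_num)
  have hZ : ∀ Z, IsPolyZeta (polygonalPoly k) Z → ∀ z, Z =ᶠ[𝓝[≠] z] quadraticZeta A c :=
    fun Z hZ ↦ eventuallyEq_nhdsNE_of_meromorphicAt_of_eqOn
      (fun z ↦ (hZ.meromorphic (Set.mem_univ z)).meromorphicAt) hG hU fun s hs ↦ by
        rw [hZ.eq_series s (hsum s hs).summable, (hsum s hs).tsum_eq]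
  refine ⟨⟨toMeromorphicNFOn (quadraticZeta A c) Set.univ, ?_, fun Z h ↦ ?_⟩, fun Z h ↦ ?_⟩
  · exact isPolyZeta_toMeromorphicNFOn hG (fun s hs ↦ analyticAt_quadraticZeta hA hc (hre s hs))
      fun s hs ↦ hsum s (hre s hs)
  · funext z
    have h1 := (hZ Z h z).trans (MeromorphicOn.toMeromorphicNFOn_eq_self_on_nhdsNE
      (fun z _ ↦ hG z) (Set.mem_univ z)).symm
    exact (((h.meromorphic (Set.mem_univ z)).eventuallyEq_nhdsNE_iff_eventuallyEq_nhds
      (meromorphicNFOn_toMeromorphicNFOn _ _ (Set.mem_univ z))).1 h1).eq_of_nhds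
  · obtain ⟨g, hg, hGg, hg0, hg'⟩ := exists_analyticAt_quadraticZeta_zero hA hc hc1
    have hZg : Z =ᶠ[𝓝 0] g :=
      ((h.meromorphic (Set.mem_univ 0)).eventuallyEq_nhdsNE_iff_eventuallyEq_nhds
        hg.meromorphicNFAt).1 ((hZ Z h 0).trans hGg)
    refine ⟨hg.congr hZg.symm, ?_, ?_, ?_⟩
    · rw [hZg.eq_of_nhds, hg0, show (c - 1) / 2 = 1 / (2 - (k : ℝ)) by
        rw [show c - 1 = -(1 - c) by ring, h1c, show 2 - (k : ℝ) = -(k - 2) by ring]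
        field_simp]
      push_cast
      rfl
    · refine (hg'.congr_of_eventuallyEq hZg).congr_deriv ?_
      congr 1
      -- This cancels one `log A`, leaving `(1 - c)/2 · log A = log A / (k - 2)`.
      have hlog : Real.log (1 - c) = -Real.log A := by
        rw [← Real.log_inv, eq_inv_of_mul_eq_one_right hAc]
      rw [hlog, show (3 - c) / 2 = 1 + (1 - c) / 2 by ring, h1c, ← hAdef]
      field_simp
      ring
    · refine hasResidueAt_of_tendsto (h.meromorphic (Set.mem_univ _)).meromorphicAt ?_
      have hval : (A : ℂ) ^ (-(1 / 2) : ℂ) / 2 = ((√(1 / (2 * ((k : ℝ) - 2))) : ℝ) : ℂ) := by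
        have e1 : √(1 / (2 * ((k : ℝ) - 2))) = A ^ (-(1 / 2) : ℝ) / 2 := by
          rw [Real.rpow_neg hA.le, ← Real.sqrt_eq_rpow, ← Real.sqrt_inv,
            Real.sqrt_eq_iff_mul_self_eq (by positivity) (by positivity), div_mul_div_comm,
            Real.mul_self_sqrt (by positivity), hAdef]
          field_simp
        rw [e1]
        push_cast [Complex.ofReal_cpow hA.le]
        rfl
      rw [← hval]
      refine (tendsto_sub_half_mul_quadraticZeta hA hc).congr' ?_
      filter_upwards [hZ Z h (1 / 2)] with z hz
      rw [hz]
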